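/- Let $\mathcal{G}\rightrightarrows M$ be a Lie groupoid, with source and target $s,t:\mathcal{G}\to M$, unit map $\iota:M\to\mathcal{G}$, manifold of composable pairs $\mathcal{G}^{(2)}=\{(g,h)\in\mathcal{G}\times\mathcal{G} : s(g)=t(h)\}$, multiplication $m:\mathcal{G}^{(2)}\to\mathcal{G}$ and projections $\mathrm{pr}_1,\mathrm{pr}_2:\mathcal{G}^{(2)}\to\mathcal{G}$. For a smooth $k$-form $\Theta\in\Omega^k(\mathcal{G})$ write $\theta:=\iota^*\Theta\in\Omega^k(M)$ for its component along the base (the $\wedge^kT^*M$-component of $\Theta|_M$). The form $\Theta$ is called multiplicative if $m^*\Theta=\mathrm{pr}_1^*\Theta+\mathrm{pr}_2^*\Theta$, and affine if $m^*\Theta=\mathrm{pr}_1^*\Theta+\mathrm{pr}_2^*\Theta-\mathrm{pr}_1^*s^*\theta$. Let $\Omega^k_{\mathrm{mult}}(\mathcal{G})$ and $\Omega^k_{\mathrm{aff}}(\mathcal{G})$ be the real vector spaces of multiplicative and of affine $k$-forms; both are preserved by the de Rham differential $d$, so that $\Omega^\bullet_{\mathrm{mult}}(\mathcal{G})$ and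 $\Omega^\bullet_{\mathrm{aff}}(\mathcal{G})$ are subcomplexes of the de Rham complex of $\mathcal{G}$, with cohomology $H^\bullet_{\mathrm{mult}}(\mathcal{G})$ and $H^\bullet_{\mathrm{aff}}(\mathcal{G})$. Let $H^\bullet(M)$ be the de Rham cohomology of $M$. Then the map \[\Phi:\Omega^\bullet_{\mathrm{aff}}(\mathcal{G})\to\Omega^\bullet_{\mathrm{mult}}(\mathcal{G})\oplus\Omega^\bullet(M),\qquad \Theta\mapsto(\Theta-t^*\theta,\ \theta),\] is well defined and is an isomorphism of cochain complexes, all differentials being the de Rham differential. Consequently $\Phi$ induces in every degree $k\ge 0$ an isomorphism \[H^k_{\mathrm{aff}}(\mathcal{G})\cong H^k_{\mathrm{mult}}(\mathcal{G})\oplus H^k(M).\] -/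

import Mathlib

open Manifold Set
open scoped ContDiff Topology

section SmoothForms

variable {E F : Type*} [NormedAddCommGroup E] [NormedSpace ℝ E]
  [NormedAddCommGroup F] [NormedSpace ℝ F] {k : ℕ}

theorem contDiff_compContinuousLinearMap :
    ContDiff ℝ ∞ (fun p : (F [⋀^Fin k]→L[ℝ] ℝ) × (E →L[ℝ] F) ↦
      p.1.compContinuousLinearMap p.2) := by
  -- antisymmetrisation, divided by `k!`, is a continuous left inverse of the inclusion of
  -- alternating maps into multilinear maps
  let A : ContinuousMultilinearMap ℝ (fun _ : Fin k ↦ E) ℝ →L[ℝ] (E [⋀^Fin k]→L[ℝ] ℝ) :=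
    LinearMap.mkContinuous
      { toFun := fun f ↦ ContinuousMultilinearMap.alternatization f
        map_add' := fun f g ↦ map_add _ f g
        map_smul' := fun c f ↦ by
          ext v
          simp [ContinuousMultilinearMap.alternatization_apply_apply, Finset.mul_sum,
            mul_smul_comm] }
      (Fintype.card (Equiv.Perm (Fin k))) (fun f ↦ by
        refine ContinuousAlternatingMap.opNorm_le_bound _ (by positivity) (fun v ↦ ?_)
        change ‖ContinuousMultilinearMap.alternatization f v‖ ≤ _
        rw [ContinuousMultilinearMap.alternatization_apply_apply]
        refine (norm_sum_le _ _).trans ?_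
        have : ∀ σ ∈ (Finset.univ : Finset (Equiv.Perm (Fin k))),
            ‖Equiv.Perm.sign σ • f (v ∘ σ)‖ ≤ ‖f‖ * ∏ i, ‖v i‖ := by
          intro σ _
          have h1 : ‖Equiv.Perm.sign σ • f (v ∘ σ)‖ = ‖f (v ∘ σ)‖ := by
            rcases Int.units_eq_one_or (Equiv.Perm.sign σ) with h | h <;> simp [h]
          rw [h1, ← Equiv.prod_comp σ (fun i ↦ ‖v i‖)]
          exact f.le_opNorm _
        refine (Finset.sum_le_sum this).trans ?_
        simp [mul_assoc])
  have hA : ∀ f : E [⋀^Fin k]→L[ℝ] ℝ,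
      ((k.factorial : ℝ)⁻¹) • A f.toContinuousMultilinearMap = f := by
    intro f
    ext v
    change (k.factorial : ℝ)⁻¹ * ContinuousMultilinearMap.alternatization _ v = _
    rw [ContinuousMultilinearMap.alternatization_apply_apply]
    have : ∀ σ ∈ (Finset.univ : Finset (Equiv.Perm (Fin k))),
        Equiv.Perm.sign σ • f.toContinuousMultilinearMap (v ∘ σ) = f v := by
      intro σ _
      have := f.toAlternatingMap.map_perm v σ
      change f (v ∘ σ) = Equiv.Perm.sign σ • f v at this
      change Equiv.Perm.sign σ • f (v ∘ σ) = f v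
      rw [this, smul_smul, Int.units_mul_self, one_smul]
    rw [Finset.sum_congr rfl this, Finset.sum_const, Finset.card_univ, Fintype.card_perm,
      Fintype.card_fin, nsmul_eq_mul, inv_mul_cancel_left₀]
    exact_mod_cast k.factorial_ne_zero
  have h : ContDiff ℝ ∞ (fun p : (F [⋀^Fin k]→L[ℝ] ℝ) × (E →L[ℝ] F) ↦
      ((k.factorial : ℝ)⁻¹) • A (ContinuousMultilinearMap.compContinuousLinearMapContinuousMultilinear
        ℝ (fun _ : Fin k ↦ E) (fun _ ↦ F) ℝ (fun _ ↦ p.2)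
          (ContinuousAlternatingMap.toContinuousMultilinearMapCLM ℝ p.1))) := by
    refine (A.contDiff.comp ?_).const_smul _
    refine ContDiff.clm_apply ?_ ?_
    · exact (ContinuousMultilinearMap.contDiff _).comp (contDiff_pi.2 fun _ ↦ contDiff_snd)
    · exact (ContinuousLinearMap.contDiff _).comp contDiff_fst
  convert h using 1
  funext p
  exact (hA _).symm

end SmoothForms

section DifferentialForms

variable {E N E' N' V : Type*}
  [NormedAddCommGroup E] [NormedSpace ℝ E] [TopologicalSpace N] [ChartedSpace E N]
  [NormedAddCommGroup E'] [NormedSpace ℝ E'] [TopologicalSpace N'] [ChartedSpace E' N']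
  [NormedAddCommGroup V] [NormedSpace ℝ V] {k : ℕ}

variable (E N) in
/-- A (not necessarily smooth) differential `k`-form on the manifold `N` modelled on `E`:
an alternating `k`-linear form on each tangent space. -/
def PointwiseForm (k : ℕ) : Type _ :=
  ∀ x : N, TangentSpace 𝓘(ℝ, E) x [⋀^Fin k]→L[ℝ] ℝ

noncomputable instance : AddCommGroup (PointwiseForm E N k) :=
  inferInstanceAs (AddCommGroup (∀ x : N, TangentSpace 𝓘(ℝ, E) x [⋀^Fin k]→L[ℝ] ℝ))

noncomputable instance : Module ℝ (PointwiseForm E N k) :=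
  inferInstanceAs (Module ℝ (∀ x : N, TangentSpace 𝓘(ℝ, E) x [⋀^Fin k]→L[ℝ] ℝ))

/-- The pullback `(f^*η)_x(v₁, …, v_k) = η_{f x}(df v₁, …, df v_k)`. -/
noncomputable def PointwiseForm.pullback (f : N → N') (η : PointwiseForm E' N' k) :
    PointwiseForm E N k :=
  fun x ↦ (η (f x)).compContinuousLinearMap (mfderiv 𝓘(ℝ, E) 𝓘(ℝ, E') f x)

/-- A form on the vector space `V`, as a function with values in the alternating forms on `V`. -/
def PointwiseForm.toFun (η : PointwiseForm V V k) : V → V [⋀^Fin k]→L[ℝ] ℝ := η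

/-- The expression of a form on `N` in the chart `e`, meaningful on `e.target`. -/
noncomputable def PointwiseForm.inChart (η : PointwiseForm E N k) (e : OpenPartialHomeomorph N E) :
    E → E [⋀^Fin k]→L[ℝ] ℝ :=
  (PointwiseForm.pullback (e.symm : E → N) η).toFun

/-- A form is smooth if its expression in each chart of the atlas is smooth. -/
def PointwiseForm.IsSmooth (η : PointwiseForm E N k) : Prop :=
  ∀ e ∈ atlas E N, ContDiffOn ℝ ∞ (η.inChart e) e.target

/-- The exterior derivative of a form: at `x`, the exterior derivative of its expression in the
preferred chart at `x`, transported back to `N`. -/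
noncomputable def PointwiseForm.d (η : PointwiseForm E N k) : PointwiseForm E N (k + 1) :=
  fun x ↦ (extDeriv (η.inChart (chartAt E x)) (chartAt E x x)).compContinuousLinearMap
    (mfderiv 𝓘(ℝ, E) 𝓘(ℝ, E) (chartAt E x) x)

theorem PointwiseForm.pullback_toFun_eventuallyEq [IsManifold 𝓘(ℝ, E) ∞ N] {U : Set V}
    (hU : IsOpen U) {f : V → N} (hf : ContMDiffOn 𝓘(ℝ, V) 𝓘(ℝ, E) ∞ f U) {y : V} (hy : y ∈ U)
    (η : PointwiseForm E N k) :
    (PointwiseForm.pullback f η).toFun =ᶠ[𝓝 y] fun z ↦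
      (η.inChart (chartAt E (f y)) (chartAt E (f y) (f z))).compContinuousLinearMap
        (fderiv ℝ (chartAt E (f y) ∘ f) z) := by
  have hfc : ContinuousAt f y := (hf.continuousOn.continuousAt (hU.mem_nhds hy))
  filter_upwards [hU.mem_nhds hy, hfc.preimage_mem_nhds
    ((chartAt E (f y)).open_source.mem_nhds (mem_chart_source E (f y))),
    eventually_eventually_nhds.2 (hfc.preimage_mem_nhds
    ((chartAt E (f y)).open_source.mem_nhds (mem_chart_source E (f y))))] with z hz hz' hz''
  set c := chartAt E (f y) with hc
  have hfz : MDifferentiableAt 𝓘(ℝ, V) 𝓘(ℝ, E) f z :=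
    (hf.contMDiffAt (hU.mem_nhds hz)).mdifferentiableAt (by simp)
  have hcM : c ∈ IsManifold.maximalAtlas 𝓘(ℝ, E) ∞ N := IsManifold.chart_mem_maximalAtlas _
  have hcz : MDifferentiableAt 𝓘(ℝ, E) 𝓘(ℝ, E) c (f z) :=
    (contMDiffAt_of_mem_maximalAtlas hcM hz').mdifferentiableAt (by simp)
  have hcz' : MDifferentiableAt 𝓘(ℝ, E) 𝓘(ℝ, E) c.symm (c (f z)) :=
    (contMDiffAt_symm_of_mem_maximalAtlas hcM (c.map_source hz')).mdifferentiableAt (by simp)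
  have hcf : MDifferentiableAt 𝓘(ℝ, V) 𝓘(ℝ, E) (c ∘ f) z := hcz.comp z hfz
  have key : mfderiv 𝓘(ℝ, V) 𝓘(ℝ, E) f z =
      (mfderiv 𝓘(ℝ, E) 𝓘(ℝ, E) c.symm (c (f z))).comp
        (mfderiv 𝓘(ℝ, V) 𝓘(ℝ, E) (c ∘ f) z) := by
    have h1 : f =ᶠ[𝓝 z] c.symm ∘ (c ∘ f) := by
      filter_upwards [hz''] with w hw
      exact (c.left_inv hw).symm
    rw [h1.mfderiv_eq]
    exact mfderiv_comp z hcz' hcf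
  have key' : (mfderiv 𝓘(ℝ, V) 𝓘(ℝ, E) (c ∘ f) z : V →L[ℝ] E) = fderiv ℝ (c ∘ f) z :=
    mfderiv_eq_fderiv
  ext v
  change η (f z) (fun i ↦ mfderiv 𝓘(ℝ, V) 𝓘(ℝ, E) f z (v i)) =
    η (c.symm (c (f z))) (fun i ↦ mfderiv 𝓘(ℝ, E) 𝓘(ℝ, E) c.symm (c (f z))
      (fderiv ℝ (c ∘ f) z (v i)))
  rw [key, ← key']
  have : ∀ (w : N), w = f z → ∀ (L : V →L[ℝ] E), η (f z) (fun i ↦ L (v i)) =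
    η w (fun i ↦ L (v i)) := by rintro _ rfl L; rfl
  exact this _ (c.left_inv hz') _

theorem two_le_infty : (2 : WithTop ℕ∞) ≤ ∞ := by
  exact WithTop.coe_le_coe.2 (le_top : (2 : ℕ∞) ≤ ⊤)

theorem PointwiseForm.pullback_toFun [IsManifold 𝓘(ℝ, E) ∞ N] {U : Set V}
    (hU : IsOpen U) {f : V → N} (hf : ContMDiffOn 𝓘(ℝ, V) 𝓘(ℝ, E) ∞ f U) {y : V} (hy : y ∈ U)
    {η : PointwiseForm E N k} (hη : η.IsSmooth) :
    ContDiffAt ℝ ∞ (PointwiseForm.pullback f η).toFun y ∧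
      extDeriv (PointwiseForm.pullback f η).toFun y = (PointwiseForm.pullback f η.d).toFun y := by
  have hev := PointwiseForm.pullback_toFun_eventuallyEq hU hf hy η
  set c := chartAt E (f y) with hc
  have hfy : ContMDiffAt 𝓘(ℝ, V) 𝓘(ℝ, E) ∞ f y := hf.contMDiffAt (hU.mem_nhds hy)
  have hcM : c ∈ IsManifold.maximalAtlas 𝓘(ℝ, E) ∞ N := IsManifold.chart_mem_maximalAtlas _
  have hcy : ContMDiffAt 𝓘(ℝ, E) 𝓘(ℝ, E) ∞ c (f y) :=
    contMDiffAt_of_mem_maximalAtlas hcM (mem_chart_source E (f y))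
  have hcf : ContDiffAt ℝ ∞ (c ∘ f) y := contMDiffAt_iff_contDiffAt.1 (hcy.comp y hfy)
  have hη' : ContDiffAt ℝ ∞ (η.inChart c) ((c ∘ f) y) :=
    (hη c (chart_mem_atlas E _)).contDiffAt
      (c.open_target.mem_nhds (c.map_source (mem_chart_source E (f y))))
  constructor
  · refine ContDiffAt.congr_of_eventuallyEq ?_ hev
    exact contDiff_compContinuousLinearMap.contDiffAt.comp y
      ((hη'.comp y hcf).prodMk (hcf.fderiv_right (m := ∞) (by simp)))
  · rw [hev.extDeriv_eq]
    have h0 := extDeriv_pullback (hη'.differentiableAt (by simp)) hcf (r := ∞)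
      (by simpa [minSmoothness] using two_le_infty)
    refine h0.trans ?_
    have h1 : (fderiv ℝ (c ∘ f) y : V →L[ℝ] E) =
        (mfderiv 𝓘(ℝ, E) 𝓘(ℝ, E) c (f y)).comp (mfderiv 𝓘(ℝ, V) 𝓘(ℝ, E) f y) := by
      rw [← mfderiv_eq_fderiv]
      exact mfderiv_comp y (hcy.mdifferentiableAt (by simp)) (hfy.mdifferentiableAt (by simp))
    rw [h1]
    rfl

theorem PointwiseForm.inChart_pullback_eqOn [IsManifold 𝓘(ℝ, E) ∞ N]
    (η : PointwiseForm E' N' k) {f : N → N'} (hf : MDifferentiable 𝓘(ℝ, E) 𝓘(ℝ, E') f)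
    {e : OpenPartialHomeomorph N E} (he : e ∈ atlas E N) :
    EqOn ((PointwiseForm.pullback f η : PointwiseForm E N k).inChart e)
      (PointwiseForm.pullback (f ∘ e.symm) η : PointwiseForm E E k).toFun e.target := by
  intro y hy
  have heM : e ∈ IsManifold.maximalAtlas 𝓘(ℝ, E) ∞ N := IsManifold.subset_maximalAtlas he
  have h := mfderiv_comp y (hf (e.symm y))
    ((contMDiffAt_symm_of_mem_maximalAtlas heM hy).mdifferentiableAt (by simp))
  ext v
  change η (f (e.symm y)) (fun i ↦ mfderiv 𝓘(ℝ, E) 𝓘(ℝ, E') f (e.symm y)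
      (mfderiv 𝓘(ℝ, E) 𝓘(ℝ, E) e.symm y (v i))) =
    η (f (e.symm y)) (fun i ↦ mfderiv 𝓘(ℝ, E) 𝓘(ℝ, E') (f ∘ e.symm) y (v i))
  rw [h]
  rfl

theorem PointwiseForm.IsSmooth.pullback [IsManifold 𝓘(ℝ, E) ∞ N] [IsManifold 𝓘(ℝ, E') ∞ N']
    {η : PointwiseForm E' N' k} (hη : η.IsSmooth) {f : N → N'}
    (hf : ContMDiff 𝓘(ℝ, E) 𝓘(ℝ, E') ∞ f) :
    (PointwiseForm.pullback f η : PointwiseForm E N k).IsSmooth := by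
  intro e he
  have heM : e ∈ IsManifold.maximalAtlas 𝓘(ℝ, E) ∞ N := IsManifold.subset_maximalAtlas he
  refine ContDiffOn.congr (fun y hy ↦ ContDiffAt.contDiffWithinAt ?_)
    (PointwiseForm.inChart_pullback_eqOn η (hf.mdifferentiable (by simp)) he)
  exact (PointwiseForm.pullback_toFun e.open_target
    (hf.comp_contMDiffOn (contMDiffOn_symm_of_mem_maximalAtlas heM)) hy hη).1

theorem PointwiseForm.IsSmooth.inChart_d_eqOn [IsManifold 𝓘(ℝ, E) ∞ N]
    {η : PointwiseForm E N k} (hη : η.IsSmooth) {e : OpenPartialHomeomorph N E}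
    (he : e ∈ atlas E N) : EqOn (η.d.inChart e) (extDeriv (η.inChart e)) e.target := by
  intro y hy
  have heM : e ∈ IsManifold.maximalAtlas 𝓘(ℝ, E) ∞ N := IsManifold.subset_maximalAtlas he
  exact (PointwiseForm.pullback_toFun e.open_target
    (contMDiffOn_symm_of_mem_maximalAtlas heM) hy hη).2.symm

theorem PointwiseForm.IsSmooth.d [IsManifold 𝓘(ℝ, E) ∞ N] {η : PointwiseForm E N k}
    (hη : η.IsSmooth) : η.d.IsSmooth := by
  intro e he
  refine ContDiffOn.congr (fun y hy ↦ ContDiffAt.contDiffWithinAt ?_) (hη.inChart_d_eqOn he)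
  have h := (hη e he).contDiffAt (e.open_target.mem_nhds hy)
  exact (ContinuousAlternatingMap.alternatizeUncurryFinCLM ℝ E ℝ).contDiff.contDiffAt.comp y
    (h.fderiv_right (m := ∞) (by simp))

theorem PointwiseForm.IsSmooth.d_d [IsManifold 𝓘(ℝ, E) ∞ N] {η : PointwiseForm E N k}
    (hη : η.IsSmooth) : η.d.d = 0 := by
  funext x
  have hx := mem_chart_target E x
  have h : η.d.inChart (chartAt E x) =ᶠ[𝓝 (chartAt E x x)] extDeriv (η.inChart (chartAt E x)) :=
    Filter.eventuallyEq_of_mem ((chartAt E x).open_target.mem_nhds hx)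
      (hη.inChart_d_eqOn (chart_mem_atlas E x))
  have h2 : extDeriv (η.d.inChart (chartAt E x)) (chartAt E x x) = 0 := by
    rw [h.extDeriv_eq]
    exact extDeriv_extDeriv_apply ((hη _ (chart_mem_atlas E x)).contDiffAt
      ((chartAt E x).open_target.mem_nhds hx)) (by simpa [minSmoothness] using two_le_infty)
  change (extDeriv (η.d.inChart (chartAt E x)) (chartAt E x x)).compContinuousLinearMap _ = 0
  rw [h2]
  rfl

theorem PointwiseForm.IsSmooth.d_pullback [IsManifold 𝓘(ℝ, E) ∞ N] [IsManifold 𝓘(ℝ, E') ∞ N']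
    {η : PointwiseForm E' N' k} (hη : η.IsSmooth) {f : N → N'}
    (hf : ContMDiff 𝓘(ℝ, E) 𝓘(ℝ, E') ∞ f) :
    (PointwiseForm.pullback f η : PointwiseForm E N k).d = PointwiseForm.pullback f η.d := by
  funext x
  set c := chartAt E x with hc
  have hx : c x ∈ c.target := mem_chart_target E x
  have hcM : c ∈ IsManifold.maximalAtlas 𝓘(ℝ, E) ∞ N := IsManifold.chart_mem_maximalAtlas _
  have h : (PointwiseForm.pullback f η : PointwiseForm E N k).inChart c =ᶠ[𝓝 (c x)]
      (PointwiseForm.pullback (f ∘ c.symm) η : PointwiseForm E E k).toFun :=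
    Filter.eventuallyEq_of_mem (c.open_target.mem_nhds hx)
      (PointwiseForm.inChart_pullback_eqOn η (hf.mdifferentiable (by simp)) (chart_mem_atlas E x))
  have h2 : extDeriv ((PointwiseForm.pullback f η : PointwiseForm E N k).inChart c) (c x) =
      (PointwiseForm.pullback (f ∘ c.symm) η.d : PointwiseForm E E (k + 1)).toFun (c x) := by
    rw [h.extDeriv_eq]
    exact (PointwiseForm.pullback_toFun c.open_target
      (hf.comp_contMDiffOn (contMDiffOn_symm_of_mem_maximalAtlas hcM)) hx hη).2
  have hcx : MDifferentiableAt 𝓘(ℝ, E) 𝓘(ℝ, E) c x :=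
    (contMDiffAt_of_mem_maximalAtlas hcM (mem_chart_source E x)).mdifferentiableAt (by simp)
  have hcx' : MDifferentiableAt 𝓘(ℝ, E) 𝓘(ℝ, E) c.symm (c x) :=
    (contMDiffAt_symm_of_mem_maximalAtlas hcM hx).mdifferentiableAt (by simp)
  have hfx : MDifferentiableAt 𝓘(ℝ, E) 𝓘(ℝ, E') f (c.symm (c x)) :=
    hf.mdifferentiable (by simp) _
  have key : mfderiv 𝓘(ℝ, E) 𝓘(ℝ, E') f x =
      (mfderiv 𝓘(ℝ, E) 𝓘(ℝ, E') (f ∘ c.symm) (c x)).comp (mfderiv 𝓘(ℝ, E) 𝓘(ℝ, E) c x) := by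
    have h1 : f =ᶠ[𝓝 x] (f ∘ c.symm) ∘ c := by
      filter_upwards [c.open_source.mem_nhds (mem_chart_source E x)] with w hw
      exact congrArg f (c.left_inv hw).symm
    rw [h1.mfderiv_eq]
    exact mfderiv_comp x (hfx.comp _ hcx') hcx
  change (extDeriv ((PointwiseForm.pullback f η : PointwiseForm E N k).inChart c)
    (c x)).compContinuousLinearMap _ = _
  rw [h2]
  ext v
  change η.d (f (c.symm (c x))) (fun i ↦ mfderiv 𝓘(ℝ, E) 𝓘(ℝ, E') (f ∘ c.symm) (c x)
      (mfderiv 𝓘(ℝ, E) 𝓘(ℝ, E) c x (v i))) =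
    η.d (f x) (fun i ↦ mfderiv 𝓘(ℝ, E) 𝓘(ℝ, E') f x (v i))
  rw [key]
  have : ∀ (w : N'), w = f x → ∀ (L : E →L[ℝ] E'), η.d w (fun i ↦ L (v i)) =
    η.d (f x) (fun i ↦ L (v i)) := by rintro _ rfl L; rfl
  exact this _ (congrArg f (c.left_inv (mem_chart_source E x)))
    ((mfderiv 𝓘(ℝ, E) 𝓘(ℝ, E') (f ∘ c.symm) (c x)).comp (mfderiv 𝓘(ℝ, E) 𝓘(ℝ, E) c x))

variable (E N) in
/-- The real vector space `Ω^k(N)` of smooth differential `k`-forms on `N`. -/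
def SmoothForm (k : ℕ) : Submodule ℝ (PointwiseForm E N k) where
  carrier := {η | η.IsSmooth}
  add_mem' := fun {_ _} ha hb e he ↦ (ha e he).add (hb e he)
  zero_mem' := fun _ _ ↦ contDiffOn_const (c := 0)
  smul_mem' := fun c _ ha e he ↦ (ha e he).const_smul c

theorem SmoothForm.isSmooth (η : SmoothForm E N k) : η.1.IsSmooth := η.2

/-- The pullback of smooth forms along a smooth map. -/
noncomputable def SmoothForm.pullback [IsManifold 𝓘(ℝ, E) ∞ N] [IsManifold 𝓘(ℝ, E') ∞ N']
    (f : N → N') (hf : ContMDiff 𝓘(ℝ, E) 𝓘(ℝ, E') ∞ f) (k : ℕ) :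
    SmoothForm E' N' k →ₗ[ℝ] SmoothForm E N k where
  toFun := fun η ↦ ⟨PointwiseForm.pullback f η.1, (SmoothForm.isSmooth η).pullback hf⟩
  map_add' := fun _ _ ↦ rfl
  map_smul' := fun _ _ ↦ rfl

variable (E N) in
/-- The de Rham differential `d : Ω^k(N) → Ω^{k+1}(N)`. -/
noncomputable def SmoothForm.d [IsManifold 𝓘(ℝ, E) ∞ N] (k : ℕ) :
    SmoothForm E N k →ₗ[ℝ] SmoothForm E N (k + 1) where
  toFun := fun η ↦ ⟨η.1.d, (SmoothForm.isSmooth η).d⟩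
  map_add' := fun a b ↦ by
    have h (x : N) {η : PointwiseForm E N k} (hη : η.IsSmooth) :
        DifferentiableAt ℝ (η.inChart (chartAt E x)) (chartAt E x x) :=
      ((hη _ (chart_mem_atlas E x)).contDiffAt ((chartAt E x).open_target.mem_nhds
        (mem_chart_target E x))).differentiableAt (by simp)
    refine Subtype.ext (funext fun x ↦ ?_)
    change (extDeriv (a.1.inChart (chartAt E x) + b.1.inChart (chartAt E x))
      (chartAt E x x)).compContinuousLinearMap _ = _
    rw [extDeriv_add (h x (SmoothForm.isSmooth a)) (h x (SmoothForm.isSmooth b))]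
    rfl
  map_smul' := fun c a ↦ by
    refine Subtype.ext (funext fun x ↦ ?_)
    change (extDeriv (c • a.1.inChart (chartAt E x))
      (chartAt E x x)).compContinuousLinearMap _ = _
    rw [extDeriv_smul]
    rfl

theorem SmoothForm.d_d [IsManifold 𝓘(ℝ, E) ∞ N] (η : SmoothForm E N k) :
    SmoothForm.d E N (k + 1) (SmoothForm.d E N k η) = 0 :=
  Subtype.ext (SmoothForm.isSmooth η).d_d

theorem SmoothForm.d_pullback [IsManifold 𝓘(ℝ, E) ∞ N] [IsManifold 𝓘(ℝ, E') ∞ N']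
    {f : N → N'} (hf : ContMDiff 𝓘(ℝ, E) 𝓘(ℝ, E') ∞ f) (η : SmoothForm E' N' k) :
    SmoothForm.d E N k (SmoothForm.pullback f hf k η) =
      SmoothForm.pullback f hf (k + 1) (SmoothForm.d E' N' k η) :=
  Subtype.ext ((SmoothForm.isSmooth η).d_pullback hf)

end DifferentialForms

section FiberProduct

variable {E E' F G G' M : Type*}
  [NormedAddCommGroup E] [NormedSpace ℝ E] [NormedAddCommGroup E'] [NormedSpace ℝ E']
  [NormedAddCommGroup F] [NormedSpace ℝ F]
  [TopologicalSpace G] [ChartedSpace E G] [TopologicalSpace G'] [ChartedSpace E' G']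
  [TopologicalSpace M] [ChartedSpace F M]
  {s : G → M} {t : G' → M}

/-- The fibre product `{(g, h) ∈ G × G' | s g = t h}` of a submersion `s : G → M` and a smooth map
`t : G' → M`, with the subspace topology. -/
def FiberProduct (_hs : IsSubmersion 𝓘(ℝ, E) 𝓘(ℝ, F) ∞ s)
    (_ht : ContMDiff 𝓘(ℝ, E') 𝓘(ℝ, F) ∞ t) : Type _ :=
  {p : G × G' // s p.1 = t p.2}

namespace FiberProduct

variable {hs : IsSubmersion 𝓘(ℝ, E) 𝓘(ℝ, F) ∞ s} {ht : ContMDiff 𝓘(ℝ, E') 𝓘(ℝ, F) ∞ t}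

instance : TopologicalSpace (FiberProduct hs ht) :=
  inferInstanceAs (TopologicalSpace {p : G × G' // s p.1 = t p.2})

/-- The point `(g, h)` of the fibre product. -/
def mk (g : G) (h : G') (hgh : s g = t h) : FiberProduct hs ht := ⟨(g, h), hgh⟩

/-- The first projection. -/
def fst (p : FiberProduct hs ht) : G := p.1.1

/-- The second projection. -/
def snd (p : FiberProduct hs ht) : G' := p.1.2

theorem condition (p : FiberProduct hs ht) : s p.fst = t p.snd := p.2

@[ext] theorem ext {p q : FiberProduct hs ht} (h₁ : p.fst = q.fst) (h₂ : p.snd = q.snd) : p = q :=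
  Subtype.ext (Prod.ext h₁ h₂)

theorem continuous_fst : Continuous (fst : FiberProduct hs ht → G) :=
  _root_.continuous_fst.comp continuous_subtype_val

theorem continuous_snd : Continuous (snd : FiberProduct hs ht → G') :=
  _root_.continuous_snd.comp continuous_subtype_val

/-- A local normal form of `s` at `g`: charts in which `s` is a linear projection. -/
theorem normalForm (hs : IsSubmersion 𝓘(ℝ, E) 𝓘(ℝ, F) ∞ s) (g : G) :
    ∃ (φ : OpenPartialHomeomorph G E) (ψ : OpenPartialHomeomorph M F)
      (e : E ≃L[ℝ] F × hs.complement), g ∈ φ.source ∧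
      φ ∈ IsManifold.maximalAtlas 𝓘(ℝ, E) ∞ G ∧ ψ ∈ IsManifold.maximalAtlas 𝓘(ℝ, F) ∞ M ∧
      (∀ g' ∈ φ.source, s g' ∈ ψ.source ∧ ψ (s g') = (e (φ g')).1) := by
  have h := hs.isSubmersionOfComplement_complement g
  refine ⟨h.domChart, h.codChart, h.equiv, h.mem_domChart_source, h.domChart_mem_maximalAtlas,
    h.codChart_mem_maximalAtlas, fun g' hg' ↦ ⟨h.source_subset_preimage_source hg', ?_⟩⟩
  have := h.writtenInCharts (show h.domChart g' ∈ (h.domChart.extend 𝓘(ℝ, E)).target by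
    rw [OpenPartialHomeomorph.extend_target]; simpa using h.domChart.map_source hg')
  simpa [h.domChart.left_inv hg'] using this

open Classical in
/-- In charts `φ`, `ψ` where `s` is the first projection of `F × K` (after the linear
identification `e`), and any chart `χ` of `G'`, the fibre product is parametrised by the
`K`-component of `φ g` and by `χ h`; the `F`-component of `φ g` is `ψ (s g) = ψ (t h)`. -/
noncomputable def chart (p₀ : FiberProduct hs ht) (φ : OpenPartialHomeomorph G E)
    (ψ : OpenPartialHomeomorph M F) (e : E ≃L[ℝ] F × hs.complement)
    (hφ : ∀ g ∈ φ.source, s g ∈ ψ.source ∧ ψ (s g) = (e (φ g)).1)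
    (χ : OpenPartialHomeomorph G' E') :
    OpenPartialHomeomorph (FiberProduct hs ht) (hs.complement × E') where
  toFun p := ((e (φ p.fst)).2, χ p.snd)
  invFun v :=
    if h : s (φ.symm (e.symm (ψ (t (χ.symm v.2)), v.1))) = t (χ.symm v.2) then mk _ _ h else p₀
  source := {p | p.fst ∈ φ.source ∧ p.snd ∈ χ.source}
  target := {v | v.2 ∈ χ.target ∧ t (χ.symm v.2) ∈ ψ.source ∧
    e.symm (ψ (t (χ.symm v.2)), v.1) ∈ φ.target}
  map_source' := by
    rintro p ⟨h1, h2⟩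
    have h3 : e.symm (ψ (t p.snd), (e (φ p.fst)).2) = φ p.fst := by
      rw [← p.condition, (hφ _ h1).2, Prod.mk.eta, e.symm_apply_apply]
    refine ⟨χ.map_source h2, ?_, ?_⟩
    · simpa only [χ.left_inv h2, ← p.condition] using (hφ _ h1).1
    · simpa only [χ.left_inv h2, h3] using φ.map_source h1
  map_target' := by
    rintro v ⟨h1, h2, h3⟩
    have h4 := hφ _ (φ.map_target h3)
    have h5 : s (φ.symm (e.symm (ψ (t (χ.symm v.2)), v.1))) = t (χ.symm v.2) := by
      refine ψ.injOn h4.1 h2 ?_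
      rw [h4.2, φ.right_inv h3, e.apply_symm_apply]
    simp only [h5, dite_true]
    exact ⟨φ.map_target h3, χ.map_target h1⟩
  left_inv' := by
    rintro p ⟨h1, h2⟩
    have h3 : φ.symm (e.symm (ψ (t (χ.symm (χ p.snd))), (e (φ p.fst)).2)) = p.fst := by
      rw [χ.left_inv h2, ← p.condition, (hφ _ h1).2, Prod.mk.eta, e.symm_apply_apply,
        φ.left_inv h1]
    have h5 : s (φ.symm (e.symm (ψ (t (χ.symm (χ p.snd))), (e (φ p.fst)).2))) =
        t (χ.symm (χ p.snd)) := by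
      rw [h3, χ.left_inv h2, p.condition]
    rw [dif_pos h5]
    exact FiberProduct.ext h3 (χ.left_inv h2)
  right_inv' := by
    rintro v ⟨h1, h2, h3⟩
    have h4 := hφ _ (φ.map_target h3)
    have h5 : s (φ.symm (e.symm (ψ (t (χ.symm v.2)), v.1))) = t (χ.symm v.2) := by
      refine ψ.injOn h4.1 h2 ?_
      rw [h4.2, φ.right_inv h3, e.apply_symm_apply]
    rw [dif_pos h5]
    refine Prod.ext ?_ (χ.right_inv h1)
    change (e (φ (φ.symm _))).2 = _
    rw [φ.right_inv h3, e.apply_symm_apply]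
  open_source := (φ.open_source.preimage continuous_fst).inter
    (χ.open_source.preimage continuous_snd)
  open_target := by
    rw [isOpen_iff_mem_nhds]
    rintro v ⟨h1, h2, h3⟩
    have c1 : ContinuousAt (fun v : hs.complement × E' ↦ χ.symm v.2) v :=
      (χ.continuousAt_symm h1).comp _root_.continuous_snd.continuousAt
    have c2 : ContinuousAt (fun v : hs.complement × E' ↦ t (χ.symm v.2)) v :=
      ht.continuous.continuousAt.comp c1
    have c3 : ContinuousAt (fun v : hs.complement × E' ↦ ψ (t (χ.symm v.2))) v :=
      ContinuousAt.comp (f := fun v : hs.complement × E' ↦ t (χ.symm v.2)) (ψ.continuousAt h2) c2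
    have c4 : ContinuousAt (fun v : hs.complement × E' ↦ e.symm (ψ (t (χ.symm v.2)), v.1)) v :=
      e.symm.continuous.continuousAt.comp (c3.prodMk _root_.continuous_fst.continuousAt)
    filter_upwards [_root_.continuous_snd.continuousAt.preimage_mem_nhds
      (χ.open_target.mem_nhds h1), c2.preimage_mem_nhds (ψ.open_source.mem_nhds h2),
      c4.preimage_mem_nhds (φ.open_target.mem_nhds h3)] with w w1 w2 w3
    exact ⟨w1, w2, w3⟩
  continuousOn_toFun := by
    rintro p ⟨h1, h2⟩
    have c1 : ContinuousAt (fun p : FiberProduct hs ht ↦ φ p.fst) p :=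
      (φ.continuousAt h1).comp continuous_fst.continuousAt
    have c2 : ContinuousAt (fun p : FiberProduct hs ht ↦ χ p.snd) p :=
      (χ.continuousAt h2).comp continuous_snd.continuousAt
    exact ((_root_.continuous_snd.continuousAt.comp
      (e.continuous.continuousAt.comp c1)).prodMk c2).continuousWithinAt
  continuousOn_invFun := by
    refine (Topology.IsInducing.subtypeVal.continuousOn_iff).2 ?_
    have key : ContinuousOn (fun v : hs.complement × E' ↦
        (φ.symm (e.symm (ψ (t (χ.symm v.2)), v.1)), χ.symm v.2)) {v | v.2 ∈ χ.target ∧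
          t (χ.symm v.2) ∈ ψ.source ∧ e.symm (ψ (t (χ.symm v.2)), v.1) ∈ φ.target} := by
      rintro v ⟨h1, h2, h3⟩
      have c1 : ContinuousAt (fun v : hs.complement × E' ↦ χ.symm v.2) v :=
        (χ.continuousAt_symm h1).comp _root_.continuous_snd.continuousAt
      have c2 : ContinuousAt (fun v : hs.complement × E' ↦ t (χ.symm v.2)) v :=
        ht.continuous.continuousAt.comp c1
      have c3 : ContinuousAt (fun v : hs.complement × E' ↦ ψ (t (χ.symm v.2))) v :=
        ContinuousAt.comp (f := fun v : hs.complement × E' ↦ t (χ.symm v.2)) (ψ.continuousAt h2) c2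
      have c4 : ContinuousAt (fun v : hs.complement × E' ↦
          e.symm (ψ (t (χ.symm v.2)), v.1)) v :=
        e.symm.continuous.continuousAt.comp (c3.prodMk _root_.continuous_fst.continuousAt)
      exact ((ContinuousAt.comp (f := fun v : hs.complement × E' ↦
          e.symm (ψ (t (χ.symm v.2)), v.1)) (φ.continuousAt_symm h3) c4).prodMk
            c1).continuousWithinAt
    refine key.congr ?_
    rintro v ⟨h1, h2, h3⟩
    have h4 := hφ _ (φ.map_target h3)
    have h5 : s (φ.symm (e.symm (ψ (t (χ.symm v.2)), v.1))) = t (χ.symm v.2) := by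
      refine ψ.injOn h4.1 h2 ?_
      rw [h4.2, φ.right_inv h3, e.apply_symm_apply]
    exact congrArg (Subtype.val : FiberProduct hs ht → G × G') (dif_pos h5)

section Charts

variable {p₀ : FiberProduct hs ht} {φ : OpenPartialHomeomorph G E}
  {ψ : OpenPartialHomeomorph M F} {e : E ≃L[ℝ] F × hs.complement}
  {hφ : ∀ g ∈ φ.source, s g ∈ ψ.source ∧ ψ (s g) = (e (φ g)).1}
  {χ : OpenPartialHomeomorph G' E'}

theorem chart_symm_apply {v : hs.complement × E'} (hv : v ∈ (chart p₀ φ ψ e hφ χ).target) :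
    ((chart p₀ φ ψ e hφ χ).symm v).fst = φ.symm (e.symm (ψ (t (χ.symm v.2)), v.1)) ∧
      ((chart p₀ φ ψ e hφ χ).symm v).snd = χ.symm v.2 := by
  obtain ⟨h1, h2, h3⟩ := hv
  have h4 := hφ _ (φ.map_target h3)
  have h5 : s (φ.symm (e.symm (ψ (t (χ.symm v.2)), v.1))) = t (χ.symm v.2) := by
    refine ψ.injOn h4.1 h2 ?_
    rw [h4.2, φ.right_inv h3, e.apply_symm_apply]
  have h6 : (chart p₀ φ ψ e hφ χ).symm v = mk _ _ h5 := dif_pos h5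
  rw [h6]
  exact ⟨rfl, rfl⟩

theorem contMDiffOn_snd_chart_symm (hχM : χ ∈ IsManifold.maximalAtlas 𝓘(ℝ, E') ∞ G') :
    ContMDiffOn 𝓘(ℝ, hs.complement × E') 𝓘(ℝ, E') ∞
      (fun v ↦ ((chart p₀ φ ψ e hφ χ).symm v).snd) (chart p₀ φ ψ e hφ χ).target := by
  have h : ContMDiffOn 𝓘(ℝ, hs.complement × E') 𝓘(ℝ, E') ∞
      (fun v : hs.complement × E' ↦ χ.symm v.2) (chart p₀ φ ψ e hφ χ).target :=
    (contMDiffOn_symm_of_mem_maximalAtlas hχM).comp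
      (contMDiff_iff_contDiff.2 contDiff_snd).contMDiffOn fun _ hv ↦ hv.1
  exact h.congr fun v hv ↦ (chart_symm_apply hv).2

theorem contMDiffOn_fst_chart_symm (hφM : φ ∈ IsManifold.maximalAtlas 𝓘(ℝ, E) ∞ G)
    (hψM : ψ ∈ IsManifold.maximalAtlas 𝓘(ℝ, F) ∞ M)
    (hχM : χ ∈ IsManifold.maximalAtlas 𝓘(ℝ, E') ∞ G') :
    ContMDiffOn 𝓘(ℝ, hs.complement × E') 𝓘(ℝ, E) ∞
      (fun v ↦ ((chart p₀ φ ψ e hφ χ).symm v).fst) (chart p₀ φ ψ e hφ χ).target := by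
  have h1 : ContMDiffOn 𝓘(ℝ, hs.complement × E') 𝓘(ℝ, E') ∞
      (fun v : hs.complement × E' ↦ χ.symm v.2) (chart p₀ φ ψ e hφ χ).target :=
    (contMDiffOn_symm_of_mem_maximalAtlas hχM).comp
      (contMDiff_iff_contDiff.2 contDiff_snd).contMDiffOn fun _ hv ↦ hv.1
  have h2 : ContDiffOn ℝ ∞ (fun v : hs.complement × E' ↦ ψ (t (χ.symm v.2)))
      (chart p₀ φ ψ e hφ χ).target :=
    contMDiffOn_iff_contDiffOn.1 <| (contMDiffOn_of_mem_maximalAtlas hψM).comp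
      (ht.comp_contMDiffOn h1) fun _ hv ↦ hv.2.1
  have h3 : ContMDiffOn 𝓘(ℝ, hs.complement × E') 𝓘(ℝ, E) ∞
      (fun v : hs.complement × E' ↦ e.symm (ψ (t (χ.symm v.2)), v.1))
      (chart p₀ φ ψ e hφ χ).target :=
    contMDiffOn_iff_contDiffOn.2 <| e.symm.contDiff.comp_contDiffOn
      (h2.prodMk contDiff_fst.contDiffOn)
  exact ((contMDiffOn_symm_of_mem_maximalAtlas hφM).comp h3 fun _ hv ↦ hv.2.2).congr
    fun v hv ↦ (chart_symm_apply hv).1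

end Charts

variable (hs ht) in
/-- The charts of the fibre product. -/
def charts : Set (OpenPartialHomeomorph (FiberProduct hs ht) (hs.complement × E')) :=
  {c | ∃ (p₀ : FiberProduct hs ht) (φ : OpenPartialHomeomorph G E)
    (ψ : OpenPartialHomeomorph M F) (e : E ≃L[ℝ] F × hs.complement)
    (hφ : ∀ g ∈ φ.source, s g ∈ ψ.source ∧ ψ (s g) = (e (φ g)).1)
    (χ : OpenPartialHomeomorph G' E'),
      φ ∈ IsManifold.maximalAtlas 𝓘(ℝ, E) ∞ G ∧ ψ ∈ IsManifold.maximalAtlas 𝓘(ℝ, F) ∞ M ∧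
      χ ∈ IsManifold.maximalAtlas 𝓘(ℝ, E') ∞ G' ∧ c = chart p₀ φ ψ e hφ χ}

theorem exists_mem_charts [IsManifold 𝓘(ℝ, E') ∞ G'] (p : FiberProduct hs ht) :
    ∃ c ∈ charts hs ht, p ∈ c.source := by
  obtain ⟨φ, ψ, e, h, hφM, hψM, hφ⟩ := normalForm hs p.fst
  exact ⟨_, ⟨p, φ, ψ, e, hφ, chartAt E' p.snd, hφM, hψM, IsManifold.chart_mem_maximalAtlas _, rfl⟩,
    h, mem_chart_source E' p.snd⟩

noncomputable instance [IsManifold 𝓘(ℝ, E') ∞ G'] :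
    ChartedSpace (hs.complement × E') (FiberProduct hs ht) where
  atlas := charts hs ht
  chartAt p := (exists_mem_charts p).choose
  mem_chart_source p := (exists_mem_charts p).choose_spec.2
  chart_mem_atlas p := (exists_mem_charts p).choose_spec.1

instance [IsManifold 𝓘(ℝ, E') ∞ G'] :
    IsManifold 𝓘(ℝ, hs.complement × E') ∞ (FiberProduct hs ht) := by
  refine isManifold_of_contDiffOn _ _ _ ?_
  rintro _ _ ⟨p₁, φ₁, ψ₁, e₁, hφ₁, χ₁, hφM₁, hψM₁, hχM₁, rfl⟩
    ⟨p₂, φ₂, ψ₂, e₂, hφ₂, χ₂, hφM₂, hψM₂, hχM₂, rfl⟩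
  set c₁ := chart p₁ φ₁ ψ₁ e₁ hφ₁ χ₁ with hc₁
  set c₂ := chart p₂ φ₂ ψ₂ e₂ hφ₂ χ₂ with hc₂
  have h1 : ContDiffOn ℝ ∞ (fun v ↦ φ₂ (c₁.symm v).fst) (c₁.symm ≫ₕ c₂).source :=
    contMDiffOn_iff_contDiffOn.1 <| (contMDiffOn_of_mem_maximalAtlas hφM₂).comp
      ((contMDiffOn_fst_chart_symm hφM₁ hψM₁ hχM₁).mono fun _ hv ↦ hv.1) fun _ hv ↦ hv.2.1
  have h2 : ContDiffOn ℝ ∞ (fun v ↦ χ₂ (c₁.symm v).snd) (c₁.symm ≫ₕ c₂).source :=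
    contMDiffOn_iff_contDiffOn.1 <| (contMDiffOn_of_mem_maximalAtlas hχM₂).comp
      ((contMDiffOn_snd_chart_symm hχM₁).mono fun _ hv ↦ hv.1) fun _ hv ↦ hv.2.2
  have h3 : ContDiffOn ℝ ∞ (fun v ↦ ((e₂ (φ₂ (c₁.symm v).fst)).2, χ₂ (c₁.symm v).snd))
      (c₁.symm ≫ₕ c₂).source :=
    (contDiff_snd.comp_contDiffOn (e₂.contDiff.comp_contDiffOn h1)).prodMk h2
  exact h3.mono fun v hv ↦ hv.1

theorem contMDiff_fst [IsManifold 𝓘(ℝ, E') ∞ G'] :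
    ContMDiff 𝓘(ℝ, hs.complement × E') 𝓘(ℝ, E) ∞ (fst : FiberProduct hs ht → G) := by
  intro p
  obtain ⟨_, ⟨p₀, φ, ψ, e, hφ, χ, hφM, hψM, hχM, rfl⟩, hp⟩ := exists_mem_charts p
  have hc : chart p₀ φ ψ e hφ χ ∈
      IsManifold.maximalAtlas 𝓘(ℝ, hs.complement × E') ∞ (FiberProduct hs ht) :=
    IsManifold.subset_maximalAtlas ⟨p₀, φ, ψ, e, hφ, χ, hφM, hψM, hχM, rfl⟩
  refine ContMDiffOn.contMDiffAt (s := (chart p₀ φ ψ e hφ χ).source) ?_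
    ((chart p₀ φ ψ e hφ χ).open_source.mem_nhds hp)
  exact ((contMDiffOn_fst_chart_symm hφM hψM hχM).comp (contMDiffOn_of_mem_maximalAtlas hc)
    fun q hq ↦ OpenPartialHomeomorph.map_source _ hq).congr fun q hq ↦
      congrArg fst (OpenPartialHomeomorph.left_inv _ hq).symm

theorem contMDiff_snd [IsManifold 𝓘(ℝ, E') ∞ G'] :
    ContMDiff 𝓘(ℝ, hs.complement × E') 𝓘(ℝ, E') ∞ (snd : FiberProduct hs ht → G') := by
  intro p
  obtain ⟨_, ⟨p₀, φ, ψ, e, hφ, χ, hφM, hψM, hχM, rfl⟩, hp⟩ := exists_mem_charts p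
  have hc : chart p₀ φ ψ e hφ χ ∈
      IsManifold.maximalAtlas 𝓘(ℝ, hs.complement × E') ∞ (FiberProduct hs ht) :=
    IsManifold.subset_maximalAtlas ⟨p₀, φ, ψ, e, hφ, χ, hφM, hψM, hχM, rfl⟩
  refine ContMDiffOn.contMDiffAt (s := (chart p₀ φ ψ e hφ χ).source) ?_
    ((chart p₀ φ ψ e hφ χ).open_source.mem_nhds hp)
  exact ((contMDiffOn_snd_chart_symm hχM).comp (contMDiffOn_of_mem_maximalAtlas hc)
    fun q hq ↦ OpenPartialHomeomorph.map_source _ hq).congr fun q hq ↦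
      congrArg snd (OpenPartialHomeomorph.left_inv _ hq).symm

end FiberProduct
end FiberProduct

open CategoryTheory CategoryTheory.Limits

universe u

/-- A Lie groupoid `G ⇉ M`, for manifolds `G`, `M` modelled on `E`, `F`: source and target maps
which are submersions, and a smooth multiplication `(g, h) ↦ g h`, defined when `s g = t h`, with
smooth units and inverses. -/
structure LieGroupoid (E F G M : Type*)
    [NormedAddCommGroup E] [NormedSpace ℝ E] [NormedAddCommGroup F] [NormedSpace ℝ F]
    [TopologicalSpace G] [ChartedSpace E G] [IsManifold 𝓘(ℝ, E) ∞ G]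
    [TopologicalSpace M] [ChartedSpace F M] [IsManifold 𝓘(ℝ, F) ∞ M] where
  /-- the source map -/
  s : G → M
  /-- the target map -/
  t : G → M
  isSubmersion_s : IsSubmersion 𝓘(ℝ, E) 𝓘(ℝ, F) ∞ s
  isSubmersion_t : IsSubmersion 𝓘(ℝ, E) 𝓘(ℝ, F) ∞ t
  /-- the multiplication, on the manifold of composable pairs -/
  mul : FiberProduct isSubmersion_s isSubmersion_t.contMDiff → G
  /-- the unit at a point of the base -/
  one : M → G
  /-- the inverse -/
  inv : G → G
  contMDiff_mul : ContMDiff 𝓘(ℝ, isSubmersion_s.complement × E) 𝓘(ℝ, E) ∞ mul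
  contMDiff_one : ContMDiff 𝓘(ℝ, F) 𝓘(ℝ, E) ∞ one
  contMDiff_inv : ContMDiff 𝓘(ℝ, E) 𝓘(ℝ, E) ∞ inv
  s_mul : ∀ p, s (mul p) = s p.snd
  t_mul : ∀ p, t (mul p) = t p.fst
  s_one : ∀ x, s (one x) = x
  t_one : ∀ x, t (one x) = x
  s_inv : ∀ g, s (inv g) = t g
  t_inv : ∀ g, t (inv g) = s g
  mul_assoc : ∀ (f g h : G) (hfg : s f = t g) (hgh : s g = t h),
    mul (.mk (mul (.mk f g hfg)) h ((s_mul (.mk f g hfg)).trans hgh)) =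
      mul (.mk f (mul (.mk g h hgh)) (hfg.trans (t_mul (.mk g h hgh)).symm))
  one_mul : ∀ g, mul (.mk (one (t g)) g (s_one _)) = g
  mul_one : ∀ g, mul (.mk g (one (s g)) (t_one _).symm) = g
  inv_mul : ∀ g, mul (.mk (inv g) g (s_inv g)) = one (s g)
  mul_inv : ∀ g, mul (.mk g (inv g) (t_inv g).symm) = one (t g)

namespace LieGroupoid

variable {E F G M : Type*}
  [NormedAddCommGroup E] [NormedSpace ℝ E] [NormedAddCommGroup F] [NormedSpace ℝ F]
  [TopologicalSpace G] [ChartedSpace E G] [IsManifold 𝓘(ℝ, E) ∞ G]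
  [TopologicalSpace M] [ChartedSpace F M] [IsManifold 𝓘(ℝ, F) ∞ M]
  (𝒢 : LieGroupoid E F G M)

theorem contMDiff_s : ContMDiff 𝓘(ℝ, E) 𝓘(ℝ, F) ∞ 𝒢.s := 𝒢.isSubmersion_s.contMDiff

theorem contMDiff_t : ContMDiff 𝓘(ℝ, E) 𝓘(ℝ, F) ∞ 𝒢.t := 𝒢.isSubmersion_t.contMDiff

/-- The manifold `G⁽²⁾` of composable pairs `(g, h)`, `s g = t h`. -/
abbrev Composable : Type _ :=
  FiberProduct 𝒢.isSubmersion_s 𝒢.isSubmersion_t.contMDiff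

/-- The model vector space of the manifold of composable pairs. -/
abbrev ComposableModel : Type _ := 𝒢.isSubmersion_s.complement × E

/-- `k`-forms on the manifold of composable pairs. -/
abbrev ComposableForm (k : ℕ) : Type _ := SmoothForm 𝒢.ComposableModel 𝒢.Composable k

/-- `m^* : Ω^k(G) → Ω^k(G⁽²⁾)`. -/
noncomputable def mulPullback (k : ℕ) : SmoothForm E G k →ₗ[ℝ] 𝒢.ComposableForm k :=
  SmoothForm.pullback 𝒢.mul 𝒢.contMDiff_mul k

/-- `pr₁^* : Ω^k(G) → Ω^k(G⁽²⁾)`. -/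
noncomputable def fstPullback (k : ℕ) : SmoothForm E G k →ₗ[ℝ] 𝒢.ComposableForm k :=
  SmoothForm.pullback FiberProduct.fst FiberProduct.contMDiff_fst k

/-- `pr₂^* : Ω^k(G) → Ω^k(G⁽²⁾)`. -/
noncomputable def sndPullback (k : ℕ) : SmoothForm E G k →ₗ[ℝ] 𝒢.ComposableForm k :=
  SmoothForm.pullback FiberProduct.snd FiberProduct.contMDiff_snd k

/-- `s^* : Ω^k(M) → Ω^k(G)`. -/
noncomputable def sourcePullback (k : ℕ) : SmoothForm F M k →ₗ[ℝ] SmoothForm E G k :=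
  SmoothForm.pullback 𝒢.s 𝒢.contMDiff_s k

/-- `t^* : Ω^k(M) → Ω^k(G)`. -/
noncomputable def targetPullback (k : ℕ) : SmoothForm F M k →ₗ[ℝ] SmoothForm E G k :=
  SmoothForm.pullback 𝒢.t 𝒢.contMDiff_t k

/-- The component `θ ∈ Ω^k(M)` of a form `Θ ∈ Ω^k(G)` along the base: the pullback of `Θ` under the
inclusion `M → G` of the units. -/
noncomputable def basePart (k : ℕ) : SmoothForm E G k →ₗ[ℝ] SmoothForm F M k :=
  SmoothForm.pullback 𝒢.one 𝒢.contMDiff_one k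

/-- The space `Ω^k_mult(G)` of multiplicative forms: `m^*Θ = pr₁^*Θ + pr₂^*Θ`. -/
def multForm (k : ℕ) : Submodule ℝ (SmoothForm E G k) where
  carrier := {Θ | 𝒢.mulPullback k Θ = 𝒢.fstPullback k Θ + 𝒢.sndPullback k Θ}
  add_mem' {a b} ha hb := by
    simp only [mem_ofPred_eq, map_add] at ha hb ⊢
    rw [ha, hb]; abel
  zero_mem' := by simp
  smul_mem' c a ha := by
    simp only [mem_ofPred_eq, map_smul] at ha ⊢
    rw [ha, smul_add]

/-- The space `Ω^k_aff(G)` of affine forms: `m^*Θ = pr₁^*Θ + pr₂^*Θ - pr₁^* s^* θ`, where `θ` is the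
component of `Θ` along the base. -/
def affineForm (k : ℕ) : Submodule ℝ (SmoothForm E G k) where
  carrier := {Θ | 𝒢.mulPullback k Θ = 𝒢.fstPullback k Θ + 𝒢.sndPullback k Θ -
    𝒢.fstPullback k (𝒢.sourcePullback k (𝒢.basePart k Θ))}
  add_mem' {a b} ha hb := by
    simp only [mem_ofPred_eq, map_add] at ha hb ⊢
    rw [ha, hb]; abel
  zero_mem' := by simp
  smul_mem' c a ha := by
    simp only [mem_ofPred_eq, map_smul] at ha ⊢
    rw [ha, smul_sub, smul_add]

theorem d_mem_multForm {k : ℕ} {Θ : SmoothForm E G k} (hΘ : Θ ∈ 𝒢.multForm k) :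
    SmoothForm.d E G k Θ ∈ 𝒢.multForm (k + 1) := by
  have h := congrArg (SmoothForm.d 𝒢.ComposableModel 𝒢.Composable k) hΘ
  rw [map_add] at h
  simp only [mulPullback, fstPullback, sndPullback, SmoothForm.d_pullback] at h
  exact h

theorem d_mem_affineForm {k : ℕ} {Θ : SmoothForm E G k} (hΘ : Θ ∈ 𝒢.affineForm k) :
    SmoothForm.d E G k Θ ∈ 𝒢.affineForm (k + 1) := by
  have h := congrArg (SmoothForm.d 𝒢.ComposableModel 𝒢.Composable k) hΘ
  rw [map_sub, map_add] at h
  simp only [mulPullback, fstPullback, sndPullback, sourcePullback, basePart,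
    SmoothForm.d_pullback] at h
  exact h

end LieGroupoid

/-- The de Rham complex `(Ω^•(N), d)`. -/
noncomputable def deRhamComplex (E N : Type u) [NormedAddCommGroup E] [NormedSpace ℝ E]
    [TopologicalSpace N] [ChartedSpace E N] [IsManifold 𝓘(ℝ, E) ∞ N] :
    CochainComplex (ModuleCat.{u} ℝ) ℕ :=
  CochainComplex.of (fun k ↦ ModuleCat.of ℝ (SmoothForm E N k))
    (fun k ↦ ModuleCat.ofHom (SmoothForm.d E N k))
    (fun _ ↦ ModuleCat.hom_ext (LinearMap.ext fun η ↦ SmoothForm.d_d η))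

namespace LieGroupoid

variable {E F G M : Type u}
  [NormedAddCommGroup E] [NormedSpace ℝ E] [NormedAddCommGroup F] [NormedSpace ℝ F]
  [TopologicalSpace G] [ChartedSpace E G] [IsManifold 𝓘(ℝ, E) ∞ G]
  [TopologicalSpace M] [ChartedSpace F M] [IsManifold 𝓘(ℝ, F) ∞ M]
  (𝒢 : LieGroupoid E F G M)

/-- The complex `(Ω^•_mult(G), d)`, with the de Rham differential. -/
noncomputable def multComplex : CochainComplex (ModuleCat.{u} ℝ) ℕ :=
  CochainComplex.of (fun k ↦ ModuleCat.of ℝ (𝒢.multForm k))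
    (fun k ↦ ModuleCat.ofHom ((SmoothForm.d E G k).restrict fun _ ↦ 𝒢.d_mem_multForm))
    (fun _ ↦ ModuleCat.hom_ext (LinearMap.ext fun Θ ↦ Subtype.ext (SmoothForm.d_d Θ.1)))

/-- The complex `(Ω^•_aff(G), d)`, with the de Rham differential. -/
noncomputable def affineComplex : CochainComplex (ModuleCat.{u} ℝ) ℕ :=
  CochainComplex.of (fun k ↦ ModuleCat.of ℝ (𝒢.affineForm k))
    (fun k ↦ ModuleCat.ofHom ((SmoothForm.d E G k).restrict fun _ ↦ 𝒢.d_mem_affineForm))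
    (fun _ ↦ ModuleCat.hom_ext (LinearMap.ext fun Θ ↦ Subtype.ext (SmoothForm.d_d Θ.1)))

end LieGroupoid

/-!
Every step is an identity between maps of manifolds, applied to pullbacks of forms.

Since `s ∘ pr₁ = t ∘ pr₂`, `t ∘ m = t ∘ pr₁` and `t ∘ ι = id`, the form `t^*θ` is affine for every
`θ ∈ Ω^k(M)`, with base component `θ`; multiplicative forms are exactly the affine forms with
vanishing base component. One direction of the latter is clear, and the other
(`LieGroupoid.basePart_eq_zero_of_mem_multForm`) is obtained by pulling back
`m^*Ω = pr₁^*Ω + pr₂^*Ω` along `x ↦ (1ₓ, 1ₓ)`, which is a smooth map `M → G⁽²⁾` because smoothness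
into the fibre product can be tested on the two projections (`FiberProduct.contMDiff_of_comp`); this
gives `ι^*Ω = 2 ι^*Ω`. So `Ω_aff = Ω_mult ⊕ t^*Ω(M)`, with projections `Θ - t^*θ` and `t^*θ`, and
the splitting commutes with `d` since `d` commutes with pullbacks. The statement on cohomology
follows because taking homology is an additive functor.
-/

/-! ### Pullbacks of forms -/

namespace SmoothForm

variable {E E' E'' N N' N'' : Type*}
  [NormedAddCommGroup E] [NormedSpace ℝ E] [NormedAddCommGroup E'] [NormedSpace ℝ E']
  [NormedAddCommGroup E''] [NormedSpace ℝ E'']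
  [TopologicalSpace N] [ChartedSpace E N] [IsManifold 𝓘(ℝ, E) ∞ N]
  [TopologicalSpace N'] [ChartedSpace E' N'] [IsManifold 𝓘(ℝ, E') ∞ N']
  [TopologicalSpace N''] [ChartedSpace E'' N''] [IsManifold 𝓘(ℝ, E'') ∞ N''] {k : ℕ}

theorem pullback_pullback {f : N → N'} (hf : ContMDiff 𝓘(ℝ, E) 𝓘(ℝ, E') ∞ f)
    {g : N' → N''} (hg : ContMDiff 𝓘(ℝ, E') 𝓘(ℝ, E'') ∞ g) (η : SmoothForm E'' N'' k) :
    pullback f hf k (pullback g hg k η) = pullback (g ∘ f) (hg.comp hf) k η := by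
  refine Subtype.ext (funext fun x ↦ ?_)
  have h := mfderiv_comp x (hg.mdifferentiable (by simp) (f x)) (hf.mdifferentiable (by simp) x)
  ext v
  change η.1 (g (f x)) (fun i ↦ mfderiv 𝓘(ℝ, E') 𝓘(ℝ, E'') g (f x)
      (mfderiv 𝓘(ℝ, E) 𝓘(ℝ, E') f x (v i))) =
    η.1 (g (f x)) (fun i ↦ mfderiv 𝓘(ℝ, E) 𝓘(ℝ, E'') (g ∘ f) x (v i))
  rw [h]
  rfl

theorem pullback_congr {f g : N → N'} (hf : ContMDiff 𝓘(ℝ, E) 𝓘(ℝ, E') ∞ f)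
    (hg : ContMDiff 𝓘(ℝ, E) 𝓘(ℝ, E') ∞ g) (h : f = g) (η : SmoothForm E' N' k) :
    pullback f hf k η = pullback g hg k η := by
  subst h; rfl

theorem pullback_id (h : ContMDiff 𝓘(ℝ, E) 𝓘(ℝ, E) ∞ (id : N → N)) (η : SmoothForm E N k) :
    pullback id h k η = η := by
  refine Subtype.ext (funext fun x ↦ ?_)
  ext v
  change η.1 x (fun i ↦ mfderiv 𝓘(ℝ, E) 𝓘(ℝ, E) id x (v i)) = η.1 x v
  rw [mfderiv_id]
  rfl

end SmoothForm

/-! ### Smooth maps into a fibre product -/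

namespace FiberProduct

variable {E E' F G G' M V N : Type*}
  [NormedAddCommGroup E] [NormedSpace ℝ E] [NormedAddCommGroup E'] [NormedSpace ℝ E']
  [NormedAddCommGroup F] [NormedSpace ℝ F] [NormedAddCommGroup V] [NormedSpace ℝ V]
  [TopologicalSpace G] [ChartedSpace E G] [TopologicalSpace G'] [ChartedSpace E' G']
  [TopologicalSpace M] [ChartedSpace F M] [TopologicalSpace N] [ChartedSpace V N]
  {s : G → M} {t : G' → M}
  {hs : IsSubmersion 𝓘(ℝ, E) 𝓘(ℝ, F) ∞ s} {ht : ContMDiff 𝓘(ℝ, E') 𝓘(ℝ, F) ∞ t}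

theorem contMDiff_of_comp [IsManifold 𝓘(ℝ, E') ∞ G'] {f : N → FiberProduct hs ht}
    (h₁ : ContMDiff 𝓘(ℝ, V) 𝓘(ℝ, E) ∞ fun x ↦ (f x).fst)
    (h₂ : ContMDiff 𝓘(ℝ, V) 𝓘(ℝ, E') ∞ fun x ↦ (f x).snd) :
    ContMDiff 𝓘(ℝ, V) 𝓘(ℝ, hs.complement × E') ∞ f := by
  intro x
  have hfc : Continuous f :=
    Continuous.subtype_mk (h₁.continuous.prodMk h₂.continuous) fun x ↦ (f x).condition
  obtain ⟨_, ⟨p₀, φ, ψ, e, hφ, χ, hφM, hψM, hχM, rfl⟩, hp⟩ := exists_mem_charts (f x)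
  set c := chart p₀ φ ψ e hφ χ
  have hc : c ∈ IsManifold.maximalAtlas 𝓘(ℝ, hs.complement × E') ∞ (FiberProduct hs ht) :=
    IsManifold.subset_maximalAtlas ⟨p₀, φ, ψ, e, hφ, χ, hφM, hψM, hχM, rfl⟩
  have g₁ : ContMDiffAt 𝓘(ℝ, V) 𝓘(ℝ, E) ∞ (fun y ↦ φ (f y).fst) x :=
    (contMDiffAt_of_mem_maximalAtlas hφM hp.1).comp x (h₁ x)
  have g₂ : ContMDiffAt 𝓘(ℝ, V) 𝓘(ℝ, E') ∞ (fun y ↦ χ (f y).snd) x :=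
    (contMDiffAt_of_mem_maximalAtlas hχM hp.2).comp x (h₂ x)
  have g₃ : ContMDiffAt 𝓘(ℝ, V) 𝓘(ℝ, hs.complement) ∞ (fun y ↦ (e (φ (f y).fst)).2) x :=
    (contMDiff_iff_contDiff.2 (contDiff_snd.comp e.contDiff)).contMDiffAt.comp x g₁
  have hcf : ContMDiffAt 𝓘(ℝ, V) 𝓘(ℝ, hs.complement × E') ∞ (fun y ↦ c (f y)) x :=
    g₃.prodMk_space g₂
  refine ((contMDiffAt_symm_of_mem_maximalAtlas hc
    (c.map_source hp)).comp x hcf).congr_of_eventuallyEq ?_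
  filter_upwards [hfc.continuousAt.preimage_mem_nhds (c.open_source.mem_nhds hp)] with y hy
  exact (c.left_inv hy).symm

end FiberProduct

/-! ### Multiplicative and affine forms -/

namespace LieGroupoid

section Forms

variable {E F G M : Type*}
  [NormedAddCommGroup E] [NormedSpace ℝ E] [NormedAddCommGroup F] [NormedSpace ℝ F]
  [TopologicalSpace G] [ChartedSpace E G] [IsManifold 𝓘(ℝ, E) ∞ G]
  [TopologicalSpace M] [ChartedSpace F M] [IsManifold 𝓘(ℝ, F) ∞ M]
  (𝒢 : LieGroupoid E F G M) {k : ℕ}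

theorem fstPullback_sourcePullback (θ : SmoothForm F M k) :
    𝒢.fstPullback k (𝒢.sourcePullback k θ) = 𝒢.sndPullback k (𝒢.targetPullback k θ) := by
  simp only [fstPullback, sndPullback, sourcePullback, targetPullback,
    SmoothForm.pullback_pullback]
  exact SmoothForm.pullback_congr _ _ (funext FiberProduct.condition) θ

theorem mulPullback_targetPullback (θ : SmoothForm F M k) :
    𝒢.mulPullback k (𝒢.targetPullback k θ) = 𝒢.fstPullback k (𝒢.targetPullback k θ) := by
  simp only [mulPullback, fstPullback, targetPullback, SmoothForm.pullback_pullback]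
  exact SmoothForm.pullback_congr _ _ (funext 𝒢.t_mul) θ

theorem basePart_targetPullback (θ : SmoothForm F M k) :
    𝒢.basePart k (𝒢.targetPullback k θ) = θ := by
  simp only [basePart, targetPullback, SmoothForm.pullback_pullback]
  exact (SmoothForm.pullback_congr _ contMDiff_id (funext 𝒢.t_one) θ).trans
    (SmoothForm.pullback_id contMDiff_id θ)

/-- The smooth map `x ↦ (1ₓ, 1ₓ)` of the base into the composable pairs. -/
def unitPair (x : M) : 𝒢.Composable :=
  .mk (𝒢.one x) (𝒢.one x) ((𝒢.s_one x).trans (𝒢.t_one x).symm)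

theorem contMDiff_unitPair : ContMDiff 𝓘(ℝ, F) 𝓘(ℝ, 𝒢.ComposableModel) ∞ 𝒢.unitPair :=
  FiberProduct.contMDiff_of_comp 𝒢.contMDiff_one 𝒢.contMDiff_one

theorem mul_unitPair (x : M) : 𝒢.mul (𝒢.unitPair x) = 𝒢.one x := by
  have h : 𝒢.unitPair x = .mk (𝒢.one x) (𝒢.one (𝒢.s (𝒢.one x))) (𝒢.t_one _).symm :=
    FiberProduct.ext rfl (congrArg 𝒢.one (𝒢.s_one x).symm)
  rw [h, 𝒢.mul_one]

theorem basePart_eq_zero_of_mem_multForm {Ω : SmoothForm E G k} (hΩ : Ω ∈ 𝒢.multForm k) :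
    𝒢.basePart k Ω = 0 := by
  have h := congrArg (SmoothForm.pullback 𝒢.unitPair 𝒢.contMDiff_unitPair k)
    (show 𝒢.mulPullback k Ω = 𝒢.fstPullback k Ω + 𝒢.sndPullback k Ω from hΩ)
  simp only [map_add, mulPullback, fstPullback, sndPullback, SmoothForm.pullback_pullback] at h
  have h' := SmoothForm.pullback_congr (𝒢.contMDiff_mul.comp 𝒢.contMDiff_unitPair) 𝒢.contMDiff_one
    (funext 𝒢.mul_unitPair) Ω
  exact left_eq_add.1 (h'.symm.trans h)

theorem sub_targetPullback_mem_multForm {Θ : SmoothForm E G k} (hΘ : Θ ∈ 𝒢.affineForm k) :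
    Θ - 𝒢.targetPullback k (𝒢.basePart k Θ) ∈ 𝒢.multForm k := by
  change 𝒢.mulPullback k Θ = _ at hΘ
  change 𝒢.mulPullback k _ = _
  simp only [map_sub]
  rw [hΘ, mulPullback_targetPullback, fstPullback_sourcePullback]
  abel

theorem add_targetPullback_mem_affineForm {Ω : SmoothForm E G k} (hΩ : Ω ∈ 𝒢.multForm k)
    (θ : SmoothForm F M k) : Ω + 𝒢.targetPullback k θ ∈ 𝒢.affineForm k := by
  have h0 := 𝒢.basePart_eq_zero_of_mem_multForm hΩ
  change 𝒢.mulPullback k Ω = _ at hΩ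
  change 𝒢.mulPullback k _ = _
  simp only [map_add]
  rw [hΩ, h0, basePart_targetPullback, mulPullback_targetPullback, map_zero, map_zero,
    fstPullback_sourcePullback]
  abel

/-- The multiplicative part `Θ ↦ Θ - t^*θ` of an affine form. -/
noncomputable def multPart (k : ℕ) : 𝒢.affineForm k →ₗ[ℝ] 𝒢.multForm k :=
  LinearMap.codRestrict _ ((LinearMap.id - 𝒢.targetPullback k ∘ₗ 𝒢.basePart k) ∘ₗ
    (𝒢.affineForm k).subtype) fun Θ ↦ 𝒢.sub_targetPullback_mem_multForm Θ.2

/-- The inclusion of the multiplicative forms into the affine forms. -/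
noncomputable def multInclusion (k : ℕ) : 𝒢.multForm k →ₗ[ℝ] 𝒢.affineForm k :=
  LinearMap.codRestrict _ (𝒢.multForm k).subtype fun Ω ↦ by
    simpa using 𝒢.add_targetPullback_mem_affineForm Ω.2 0

/-- The map `θ ↦ t^*θ`, with values in the affine forms. -/
noncomputable def targetAffine (k : ℕ) : SmoothForm F M k →ₗ[ℝ] 𝒢.affineForm k :=
  LinearMap.codRestrict _ (𝒢.targetPullback k) fun θ ↦ by
    simpa using 𝒢.add_targetPullback_mem_affineForm (𝒢.multForm k).zero_mem θ

end Forms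

/-! ### The isomorphism of complexes -/

section Complexes

variable {E F G M : Type u}
  [NormedAddCommGroup E] [NormedSpace ℝ E] [NormedAddCommGroup F] [NormedSpace ℝ F]
  [TopologicalSpace G] [ChartedSpace E G] [IsManifold 𝓘(ℝ, E) ∞ G]
  [TopologicalSpace M] [ChartedSpace F M] [IsManifold 𝓘(ℝ, F) ∞ M]
  (𝒢 : LieGroupoid E F G M)

theorem _root_.deRhamComplex_d (E N : Type u) [NormedAddCommGroup E] [NormedSpace ℝ E]
    [TopologicalSpace N] [ChartedSpace E N] [IsManifold 𝓘(ℝ, E) ∞ N] (k : ℕ) :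
    (deRhamComplex E N).d k (k + 1) = ModuleCat.ofHom (SmoothForm.d E N k) :=
  CochainComplex.of_d (fun k ↦ ModuleCat.of ℝ (SmoothForm E N k))
    (fun k ↦ ModuleCat.ofHom (SmoothForm.d E N k)) k

theorem multComplex_d (k : ℕ) : 𝒢.multComplex.d k (k + 1) =
    ModuleCat.ofHom ((SmoothForm.d E G k).restrict fun _ ↦ 𝒢.d_mem_multForm) :=
  CochainComplex.of_d (fun k ↦ ModuleCat.of ℝ (𝒢.multForm k))
    (fun k ↦ ModuleCat.ofHom ((SmoothForm.d E G k).restrict fun _ ↦ 𝒢.d_mem_multForm)) k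

theorem affineComplex_d (k : ℕ) : 𝒢.affineComplex.d k (k + 1) =
    ModuleCat.ofHom ((SmoothForm.d E G k).restrict fun _ ↦ 𝒢.d_mem_affineForm) :=
  CochainComplex.of_d (fun k ↦ ModuleCat.of ℝ (𝒢.affineForm k))
    (fun k ↦ ModuleCat.ofHom ((SmoothForm.d E G k).restrict fun _ ↦ 𝒢.d_mem_affineForm)) k

/-- The cochain map `Θ ↦ Θ - t^*θ`. -/
noncomputable def multPartHom : 𝒢.affineComplex ⟶ 𝒢.multComplex :=
  CochainComplex.ofHom (fun k ↦ ModuleCat.ofHom (𝒢.multPart k)) fun k ↦ by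
    rw [affineComplex_d, multComplex_d]
    ext Θ
    refine Subtype.ext ?_
    change SmoothForm.d E G k (Θ.1 - 𝒢.targetPullback k (𝒢.basePart k Θ.1)) =
      SmoothForm.d E G k Θ.1 - 𝒢.targetPullback (k + 1) (𝒢.basePart (k + 1) (SmoothForm.d E G k Θ.1))
    rw [map_sub]
    simp only [targetPullback, basePart, SmoothForm.d_pullback]

/-- The cochain map `Θ ↦ θ`. -/
noncomputable def basePartHom : 𝒢.affineComplex ⟶ deRhamComplex F M :=
  CochainComplex.ofHom
    (fun k ↦ ModuleCat.ofHom (𝒢.basePart k ∘ₗ (𝒢.affineForm k).subtype)) fun k ↦ by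
    rw [affineComplex_d, deRhamComplex_d]
    ext Θ
    exact SmoothForm.d_pullback 𝒢.contMDiff_one Θ.1

/-- The inclusion of the multiplicative forms into the affine forms, as a cochain map. -/
noncomputable def multInclusionHom : 𝒢.multComplex ⟶ 𝒢.affineComplex :=
  CochainComplex.ofHom (fun k ↦ ModuleCat.ofHom (𝒢.multInclusion k)) fun k ↦ by
    rw [multComplex_d, affineComplex_d]
    rfl

/-- The cochain map `θ ↦ t^*θ` into the affine forms. -/
noncomputable def targetAffineHom : deRhamComplex F M ⟶ 𝒢.affineComplex :=
  CochainComplex.ofHom (fun k ↦ ModuleCat.ofHom (𝒢.targetAffine k)) fun k ↦ by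
    rw [deRhamComplex_d, affineComplex_d]
    ext θ
    exact Subtype.ext (SmoothForm.d_pullback 𝒢.contMDiff_t θ)

theorem multInclusionHom_multPartHom : 𝒢.multInclusionHom ≫ 𝒢.multPartHom = 𝟙 _ := by
  ext k Ω
  refine Subtype.ext ?_
  change Ω.1 - 𝒢.targetPullback k (𝒢.basePart k Ω.1) = Ω.1
  rw [𝒢.basePart_eq_zero_of_mem_multForm Ω.2, map_zero, sub_zero]

theorem multInclusionHom_basePartHom : 𝒢.multInclusionHom ≫ 𝒢.basePartHom = 0 := by
  ext k Ω
  exact 𝒢.basePart_eq_zero_of_mem_multForm Ω.2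

theorem targetAffineHom_multPartHom : 𝒢.targetAffineHom ≫ 𝒢.multPartHom = 0 := by
  ext k θ
  refine Subtype.ext ?_
  change 𝒢.targetPullback k θ - 𝒢.targetPullback k (𝒢.basePart k (𝒢.targetPullback k θ)) = 0
  exact sub_eq_zero.2 (congrArg _ (𝒢.basePart_targetPullback θ).symm)

theorem targetAffineHom_basePartHom : 𝒢.targetAffineHom ≫ 𝒢.basePartHom = 𝟙 _ := by
  ext k θ
  exact 𝒢.basePart_targetPullback θ

theorem multPartHom_add_basePartHom :
    𝒢.multPartHom ≫ 𝒢.multInclusionHom + 𝒢.basePartHom ≫ 𝒢.targetAffineHom = 𝟙 _ := by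
  ext k Θ
  refine Subtype.ext ?_
  change Θ.1 - 𝒢.targetPullback k (𝒢.basePart k Θ.1) + 𝒢.targetPullback k (𝒢.basePart k Θ.1) = Θ.1
  exact sub_add_cancel _ _

/-- The isomorphism `Θ ↦ (Θ - t^*θ, θ)`, with inverse `(Ω, θ) ↦ Ω + t^*θ`. -/
noncomputable def affineIso : 𝒢.affineComplex ≅ 𝒢.multComplex ⊞ deRhamComplex F M where
  hom := biprod.lift 𝒢.multPartHom 𝒢.basePartHom
  inv := biprod.desc 𝒢.multInclusionHom 𝒢.targetAffineHom
  hom_inv_id := by rw [biprod.lift_desc, multPartHom_add_basePartHom]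
  inv_hom_id := by
    apply biprod.hom_ext' <;> apply biprod.hom_ext <;>
      simp [multInclusionHom_multPartHom, multInclusionHom_basePartHom,
        targetAffineHom_multPartHom, targetAffineHom_basePartHom]

end Complexes

end LieGroupoid

/-- A functor which preserves biproducts takes an isomorphism onto a biproduct to an isomorphism onto
the biproduct of the images. -/
theorem CategoryTheory.Functor.isIso_biprod_lift_map {C D : Type*} [Category* C] [Category* D]
    [Preadditive C] [Preadditive D] [HasBinaryBiproducts C] [HasBinaryBiproducts D] (H : C ⥤ D)
    [H.PreservesZeroMorphisms] [PreservesBinaryBiproducts H] {K L L' : C} (Φ : K ≅ L ⊞ L') :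
    IsIso (biprod.lift (H.map (Φ.hom ≫ biprod.fst)) (H.map (Φ.hom ≫ biprod.snd))) := by
  have h : biprod.lift (H.map (Φ.hom ≫ biprod.fst)) (H.map (Φ.hom ≫ biprod.snd)) =
      H.map Φ.hom ≫ (H.mapBiprod L L').hom := by
    apply biprod.hom_ext
    · rw [biprod.lift_fst, H.map_comp]
      exact (congrArg (H.map Φ.hom ≫ ·) (biprod.lift_fst _ _).symm).trans (Category.assoc _ _ _).symm
    · rw [biprod.lift_snd, H.map_comp]
      exact (congrArg (H.map Φ.hom ≫ ·) (biprod.lift_snd _ _).symm).trans (Category.assoc _ _ _).symm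
  rw [h]
  infer_instance

theorem mainTheorem9 {E F G M : Type u}
    [NormedAddCommGroup E] [NormedSpace ℝ E] [FiniteDimensional ℝ E]
    [NormedAddCommGroup F] [NormedSpace ℝ F] [FiniteDimensional ℝ F]
    [TopologicalSpace G] [ChartedSpace E G] [IsManifold 𝓘(ℝ, E) ∞ G]
    [TopologicalSpace M] [ChartedSpace F M] [IsManifold 𝓘(ℝ, F) ∞ M]
    (𝒢 : LieGroupoid E F G M) :
    ∃ Φ : 𝒢.affineComplex ≅ 𝒢.multComplex ⊞ deRhamComplex F M,
      (∀ (k : ℕ) (Θ : 𝒢.affineForm k),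
        (𝒢.multForm k).subtype ((Φ.hom ≫ biprod.fst).f k Θ) =
            Θ - 𝒢.targetPullback k (𝒢.basePart k Θ) ∧
          ((Φ.hom ≫ biprod.snd).f k Θ : SmoothForm F M k) = 𝒢.basePart k Θ) ∧
      ∀ k : ℕ, IsIso (biprod.lift
        (HomologicalComplex.homologyMap (Φ.hom ≫ biprod.fst) k)
        (HomologicalComplex.homologyMap (Φ.hom ≫ biprod.snd) k)) := by
  refine ⟨𝒢.affineIso, fun k Θ ↦ ⟨?_, ?_⟩,
    fun k ↦ ?_⟩
  · rw [show 𝒢.affineIso.hom ≫ biprod.fst = 𝒢.multPartHom from biprod.lift_fst _ _]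
    rfl
  · rw [show 𝒢.affineIso.hom ≫ biprod.snd = 𝒢.basePartHom from biprod.lift_snd _ _]
    rfl
  · have := preservesBinaryBiproducts_of_preservesBinaryProducts
      (HomologicalComplex.homologyFunctor (ModuleCat.{u} ℝ) (ComplexShape.up ℕ) k)
    exact (HomologicalComplex.homologyFunctor (ModuleCat.{u} ℝ) (ComplexShape.up ℕ)
      k).isIso_biprod_lift_map 𝒢.affineIso
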